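/- Let $\Bbbk$ be a field and $a=(a_i)_{i\in\mathbb Z}$ a sequence in $\Bbbk$. Let $\mathbf{Sym}^a=\Bbbk\langle S_{1;a},S_{2;a},\ldots\rangle$ be the free associative algebra, $S_{0;a}=1$, and let $F$ be the skew field freely generated by $S_{1;a},S_{2;a},\ldots$ (the universal field of fractions of $\mathbf{Sym}^a$, i.e. its universal localization at all full square matrices). Put $(t|a)^k=(t-a_1)\cdots(t-a_k)$ and $(\tau^l a)_i=a_{i+l}$. For $s\in\mathbb Z$ define $S_{k;a}^{[s]}\in\mathbf{Sym}^a$, $k\ge 0$, by the identity of formal power series in $1/t$ $$\sum_{k\ge 0}\frac{S_{k;a}^{[s]}}{(t|\tau^{-s}a)^k}=\sum_{k\ge 0}\frac{S_{k;a}}{(t|a)^k},$$ and put $S_{k;a}^{[s]}=0$ for $k<0$. For a square matrix $A$ over a ring, let $A^{pq}$ be $A$ with row $p$ and column $q$ removed; the quasideterminant $|A|_{pq}=a_{pq}-\sum_{i\ne p,\,j\ne q}a_{pj}\,\big((A^{pq})^{-1}\big)_{ji}\,a_{iq}$ is defined if $A^{pq}$ is invertible. For a partition $\lambda=(\lambda_1\le\lambda_2\le\cdots\le\lambda_n)$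 with $n\ge1$ positive parts, the $a$-shifted quasi-Schur function is $$\breve S_{\lambda;a}=(-1)^{n-1}\,|M_\lambda|_{1n}\in F,\qquad M_\lambda=\big(S_{\lambda_j+j-i;a}^{[n-i]}\big)_{1\le i,j\le n}.$$ For integers $b,m\ge 0$ let $(b|m)$ be the hook partition $(1^b,m+1)$. Write $\lambda=(\beta_1,\ldots,\beta_k|\alpha_1,\ldots,\alpha_k)$ in Frobenius notation, listed increasingly: $k$ is the number of boxes on the main diagonal of the diagram of $\lambda$, $\alpha_1<\cdots<\alpha_k$ are the arm lengths and $\beta_1<\cdots<\beta_k$ the leg lengths of these boxes. Then the quasideterminants defining $\breve S_{\lambda;a}$ and all $\breve S_{(\beta_i|\alpha_j);a}$, $1\le i,j\le k$, are defined in $F$, the quasideterminant at position $(k,k)$ of the $k\times k$ matrix $\big(\breve S_{(\beta_i|\alpha_j);a}\big)_{i,j}$ is defined in $F$, and $$\breve S_{\lambda;a}=\left|\big(\breve S_{(\beta_i|\alpha_j);a}\big)_{1\le i,j\le k}\right|_{kk}.$$ -/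

import Mathlib

noncomputable section

namespace ShiftedNSym

/-! ### The algebra of noncommutative `a`-shifted symmetric functions -/

/-- The free associative algebra on generators `S₁, S₂, …`. -/
abbrev Sym (𝕜 : Type*) [Field 𝕜] : Type _ := FreeAlgebra 𝕜 ℕ+

/-- The generators `S_k`, with the convention `S₀ = 1`. -/
def genS (𝕜 : Type*) [Field 𝕜] (k : ℕ) : Sym 𝕜 :=
  if h : 0 < k then FreeAlgebra.ι 𝕜 (⟨k, h⟩ : ℕ+) else 1

/-- The shift `τ^l` of a parameter sequence: `(τ^l a)_i = a_{i + l}`. -/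
def tau {𝕜 : Type*} (l : ℤ) (a : ℤ → 𝕜) : ℤ → 𝕜 := fun i => a (i + l)

/-- The expansion of `1 / ((t - a₁) ⋯ (t - a_k))` as a formal power series in `X = 1 / t`;
each factor is `1 / (t - a_i) = X / (1 - a_i X)`. -/
def invPow {𝕜 : Type*} [Field 𝕜] (a : ℤ → 𝕜) (k : ℕ) : PowerSeries 𝕜 :=
  ∏ i ∈ Finset.Icc 1 k,
    (PowerSeries.X * (1 - PowerSeries.C (a (i : ℤ)) * PowerSeries.X)⁻¹)

/-- The series `∑_{k ≥ 0} c_k / ((t - a₁) ⋯ (t - a_k))` as a formal power series in `X = 1 / t`.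
The `k`-th summand is divisible by `X ^ k`, so only `k ≤ m` contributes to the `m`-th
coefficient. -/
def genSeries {𝕜 : Type*} [Field 𝕜] (a : ℤ → 𝕜) (c : ℕ → Sym 𝕜) : PowerSeries (Sym 𝕜) :=
  PowerSeries.mk fun m =>
    ∑ k ∈ Finset.range (m + 1), (PowerSeries.coeff m (invPow a k)) • c k

/-- The shifts `S_{k;a}^{[s]}`, determined by
`∑_k S_{k;a}^{[s]} / (t | τ^{-s} a)^k = ∑_k S_{k;a} / (t | a)^k`
(see `genSeries_shiftS` and `eq_shiftS`), solved coefficient by coefficient. -/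
def shiftS {𝕜 : Type*} [Field 𝕜] (a : ℤ → 𝕜) (s : ℤ) : ℕ → Sym 𝕜
  | m => PowerSeries.coeff m (genSeries a (genS 𝕜)) -
      ∑ k : Fin m, (PowerSeries.coeff m (invPow (tau (-s) a) k)) • shiftS a s k
  termination_by m => m
  decreasing_by exact k.2

theorem invPow_coeff_self {𝕜 : Type*} [Field 𝕜] (a : ℤ → 𝕜) (k : ℕ) :
    PowerSeries.coeff k (invPow a k) = 1 := by
  unfold invPow
  rw [Finset.prod_mul_distrib, Finset.prod_const, Nat.card_Icc, Nat.add_sub_cancel]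
  rw [PowerSeries.coeff_X_pow_mul']
  simp [map_prod]

/-- The defining equation of the shifts `S_{k;a}^{[s]}`. -/
theorem genSeries_shiftS {𝕜 : Type*} [Field 𝕜] (a : ℤ → 𝕜) (s : ℤ) :
    genSeries (tau (-s) a) (shiftS a s) = genSeries a (genS 𝕜) := by
  ext m
  conv_lhs => rw [genSeries, PowerSeries.coeff_mk]
  rw [Finset.sum_range_succ, invPow_coeff_self, one_smul]
  conv_lhs => arg 2; rw [shiftS]
  rw [Finset.sum_range fun k =>
    (PowerSeries.coeff m (invPow (tau (-s) a) k)) • shiftS a s k]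
  abel

/-- The defining equation determines the shifts `S_{k;a}^{[s]}`. -/
theorem eq_shiftS {𝕜 : Type*} [Field 𝕜] (a : ℤ → 𝕜) (s : ℤ) (c : ℕ → Sym 𝕜)
    (hc : genSeries (tau (-s) a) c = genSeries a (genS 𝕜)) : c = shiftS a s := by
  funext m
  induction m using Nat.strong_induction_on with
  | _ m ih =>
    have h := congrArg (PowerSeries.coeff m) (hc.trans (genSeries_shiftS a s).symm)
    simp only [genSeries, PowerSeries.coeff_mk] at h
    rw [Finset.sum_range_succ, Finset.sum_range_succ, invPow_coeff_self, one_smul,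
      one_smul, Finset.sum_congr rfl fun k hk => by rw [ih k (Finset.mem_range.1 hk)]] at h
    exact add_left_cancel h

/-- `S_{k;a}^{[s]}` for an integer index `k`, with `S_{k;a}^{[s]} = 0` for `k < 0`. -/
def shiftSZ {𝕜 : Type*} [Field 𝕜] (a : ℤ → 𝕜) (s : ℤ) (k : ℤ) : Sym 𝕜 :=
  if k < 0 then 0 else shiftS a s k.toNat

/-! ### The free skew field -/

/-- A square matrix over a ring is full if it is not a product of an `n × r` and an `r × n`
matrix with `r < n`. -/
def IsFull {R : Type*} [Ring R] {n : ℕ} (A : Matrix (Fin n) (Fin n) R) : Prop :=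
  ∀ (r : ℕ) (P : Matrix (Fin n) (Fin r) R) (Q : Matrix (Fin r) (Fin n) R), A = P * Q → n ≤ r

/-- A symbol for the entry `(row, col)` of the inverse of the full matrix `mat`. -/
structure InvSymbol (𝕜 : Type*) [Field 𝕜] where
  size : ℕ
  mat : Matrix (Fin size) (Fin size) (Sym 𝕜)
  full : IsFull mat
  row : Fin size
  col : Fin size

/-- The free algebra on the `S_k` and on the entries of the inverses of all full matrices. -/
abbrev PreFreeField (𝕜 : Type*) [Field 𝕜] : Type _ := FreeAlgebra 𝕜 (ℕ+ ⊕ InvSymbol 𝕜)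

/-- The inclusion of the free algebra on the `S_k`. -/
def preEmbed (𝕜 : Type*) [Field 𝕜] : Sym 𝕜 →ₐ[𝕜] PreFreeField 𝕜 :=
  FreeAlgebra.lift 𝕜 fun i => FreeAlgebra.ι 𝕜 (Sum.inl i)

/-- The relations that make the matrix of inverse symbols of a full matrix `A` a two-sided
inverse of `A`. -/
inductive FreeFieldRel (𝕜 : Type*) [Field 𝕜] : PreFreeField 𝕜 → PreFreeField 𝕜 → Prop
  | mul_inv (n : ℕ) (A : Matrix (Fin n) (Fin n) (Sym 𝕜)) (hA : IsFull A) (i j : Fin n) :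
      FreeFieldRel 𝕜
        (∑ l, preEmbed 𝕜 (A i l) * FreeAlgebra.ι 𝕜 (Sum.inr ⟨n, A, hA, l, j⟩))
        (if i = j then 1 else 0)
  | inv_mul (n : ℕ) (A : Matrix (Fin n) (Fin n) (Sym 𝕜)) (hA : IsFull A) (i j : Fin n) :
      FreeFieldRel 𝕜
        (∑ l, FreeAlgebra.ι 𝕜 (Sum.inr ⟨n, A, hA, i, l⟩) * preEmbed 𝕜 (A l j))
        (if i = j then 1 else 0)

/-- The skew field freely generated by `S₁, S₂, …`, i.e. the universal field of fractions of the
free algebra on the `S_k`. By a theorem of Cohn it is the universal localization of the free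
algebra at all full matrices, which is how it is constructed here. -/
abbrev FreeField (𝕜 : Type*) [Field 𝕜] : Type _ := RingQuot (FreeFieldRel 𝕜)

/-- The canonical map from the free algebra to the free skew field. -/
def toFreeField (𝕜 : Type*) [Field 𝕜] : Sym 𝕜 →ₐ[𝕜] FreeField 𝕜 :=
  (RingQuot.mkAlgHom 𝕜 (FreeFieldRel 𝕜)).comp (preEmbed 𝕜)

/-! ### Quasideterminants -/

/-- The matrix `A^{pq}`: row `p` and column `q` are deleted. -/
def minor {R : Type*} {n : ℕ} (A : Matrix (Fin (n + 1)) (Fin (n + 1)) R)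
    (p q : Fin (n + 1)) : Matrix (Fin n) (Fin n) R :=
  A.submatrix p.succAbove q.succAbove

/-- The quasideterminant `|A|_{pq}` is defined when `A^{pq}` is invertible. -/
def QuasidetDefined {R : Type*} [Ring R] {n : ℕ} (A : Matrix (Fin (n + 1)) (Fin (n + 1)) R)
    (p q : Fin (n + 1)) : Prop :=
  IsUnit (minor A p q)

/-- The quasideterminant
`|A|_{pq} = a_{pq} - ∑_{i ≠ p, j ≠ q} a_{pj} ((A^{pq})⁻¹)_{ji} a_{iq}`.
It is meaningful when `QuasidetDefined A p q` holds. -/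
def quasidet {R : Type*} [Ring R] {n : ℕ} (A : Matrix (Fin (n + 1)) (Fin (n + 1)) R)
    (p q : Fin (n + 1)) : R :=
  A p q - ∑ j : Fin n, ∑ i : Fin n,
    A p (q.succAbove j) * Ring.inverse (minor A p q) j i * A (p.succAbove i) q

/-! ### Quasi-Schur functions -/

/-- The matrix with entries `S_{λ_j + j - i; a}^{[N - i]}`, `1 ≤ i, j ≤ N`, for a sequence `λ` of
length `N = n + 1` (row and column indices below start at `0`). -/
def quasiSchurMatrix {𝕜 : Type*} [Field 𝕜] (a : ℤ → 𝕜) {n : ℕ} (lam : Fin (n + 1) → ℕ) :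
    Matrix (Fin (n + 1)) (Fin (n + 1)) (FreeField 𝕜) :=
  Matrix.of fun i j =>
    toFreeField 𝕜 (shiftSZ a ((n : ℤ) - (i : ℤ)) ((lam j : ℤ) + (j : ℤ) - (i : ℤ)))

/-- The multiparameter quasi-Schur function of `λ = (λ₁ ≤ ⋯ ≤ λ_N)`, `N = n + 1`: `(-1)^{N-1}`
times the quasideterminant at the top right corner. -/
def quasiSchur {𝕜 : Type*} [Field 𝕜] (a : ℤ → 𝕜) {n : ℕ} (lam : Fin (n + 1) → ℕ) :
    FreeField 𝕜 :=
  (-1) ^ n * quasidet (quasiSchurMatrix a lam) 0 (Fin.last n)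

/-- The hook partition `(b | m) = (1^b, m + 1)`. -/
def hook (b m : ℕ) : Fin (b + 1) → ℕ :=
  Fin.snoc (α := fun _ => ℕ) (fun _ => 1) (m + 1)

/-! ### Frobenius notation -/

/-- Length of the `r`-th longest row (`r = 0, 1, …`) of the diagram of `λ₁ ≤ ⋯ ≤ λ_N`. -/
def rowLen {n : ℕ} (lam : Fin (n + 1) → ℕ) (r : ℕ) : ℕ :=
  if h : r < n + 1 then lam (Fin.rev ⟨r, h⟩) else 0

/-- Length of the `c`-th longest column (`c = 0, 1, …`) of the diagram of `λ₁ ≤ ⋯ ≤ λ_N`. -/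
def colLen {n : ℕ} (lam : Fin (n + 1) → ℕ) (c : ℕ) : ℕ :=
  (Finset.univ.filter fun i => c < lam i).card

/-- `λ = (β₁, …, β_k | α₁, …, α_k)` in Frobenius notation, listed increasingly: the diagram of `λ`
has exactly `k` diagonal boxes, and the box `(i, i)` (`i = 0, …, k - 1`, longest row first) has arm
length `α_{k-i}` and leg length `β_{k-i}`. -/
structure IsFrobenius {n k : ℕ} (lam : Fin (n + 1) → ℕ) (β α : Fin k → ℕ) : Prop where
  diag : ∀ i : ℕ, i < rowLen lam i ↔ i < k
  arm : ∀ i : Fin k, rowLen lam i = α i.rev + i + 1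
  leg : ∀ i : Fin k, colLen lam i = β i.rev + i + 1

/-- The matrix of the hook quasi-Schur functions `S̆_{(β_i | α_j); a}`. -/
def giambelliMatrix {𝕜 : Type*} [Field 𝕜] (a : ℤ → 𝕜) {k : ℕ} (β α : Fin k → ℕ) :
    Matrix (Fin k) (Fin k) (FreeField 𝕜) :=
  Matrix.of fun i j => quasiSchur a (hook (β i) (α j))

end ShiftedNSym

end

open ShiftedNSym

open ShiftedNSym

namespace ShiftedNSym

/-! ### Full matrices and the free skew field -/

/-! With the rows of `M_λ` reversed, row `p` carries the shift `[p]`, and a column is determined by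
its position `μ`: its entries are `S_{μ+p+1}^{[p]}`. The columns through the diagonal boxes sit at
the arm lengths `α_i`. The others sit at `-1-b`, where `b` runs through the row indices that are not
leg lengths (`IsFrobenius.exists_positions`).

The column at position `-1-b` is column `b` of the lower unitriangular matrix `L = (S_{p-j}^{[p]})`.
Multiplying by `T = L⁻¹` turns it into a unit vector, and turns the column at position `m ≥ 0` into
the signed hook functions `(-1)^b S̆_{(b|m)}` (`quasiSchur_hook`). Up to row signs, the hook matrix
is thus what remains of `T M` after the unit columns and their rows are struck out.

A quasideterminant is the value on the distinguished column of a row vector that kills the other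
columns and is `1` at the distinguished row (`quasidet_eq_sum_of_annihilates`). Such a vector for
`M_λ`, multiplied by `L`, vanishes on the struck rows, so it restricts to one for the hook matrix.

All inverses exist because matrices with strictly increasing positions that are not too negative
have a commutative specialization with nonzero determinant, hence are full
(`exists_det_posMatrix_ne_zero`). -/

theorem isFull_of_det_map_ne_zero {R K : Type*} [Ring R] [Field K] {n : ℕ}
    (A : Matrix (Fin n) (Fin n) R) (φ : R →+* K) (h : (A.map φ).det ≠ 0) : IsFull A := by
  rintro r P Q rfl
  have hu : IsUnit ((P * Q).map φ) := (Matrix.isUnit_iff_isUnit_det _).2 h.isUnit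
  have hr := Matrix.rank_of_isUnit _ hu
  rw [Matrix.map_mul, Fintype.card_fin] at hr
  calc n = _ := hr.symm
    _ ≤ (P.map φ).rank := Matrix.rank_mul_le_left _ _
    _ ≤ r := Matrix.rank_le_width _

/-- The only property of the free skew field that the argument uses: full matrices become invertible
by construction. -/
theorem isUnit_map_toFreeField {𝕜 : Type*} [Field 𝕜] {n : ℕ} {A : Matrix (Fin n) (Fin n) (Sym 𝕜)}
    (hA : IsFull A) : IsUnit (A.map (toFreeField 𝕜)) := by
  let B : Matrix (Fin n) (Fin n) (FreeField 𝕜) := Matrix.of fun i j =>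
    RingQuot.mkAlgHom 𝕜 (FreeFieldRel 𝕜) (FreeAlgebra.ι 𝕜 (Sum.inr ⟨n, A, hA, i, j⟩))
  refine ⟨⟨A.map (toFreeField 𝕜), B, ?_, ?_⟩, rfl⟩
  · ext i j
    have h := RingQuot.mkAlgHom_rel 𝕜 (FreeFieldRel.mul_inv n A hA i j)
    simp only [map_sum, map_mul, apply_ite (RingQuot.mkAlgHom 𝕜 (FreeFieldRel 𝕜)), map_one,
      map_zero] at h
    rw [Matrix.one_apply, ← h, Matrix.mul_apply]
    rfl
  · ext i j
    have h := RingQuot.mkAlgHom_rel 𝕜 (FreeFieldRel.inv_mul n A hA i j)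
    simp only [map_sum, map_mul, apply_ite (RingQuot.mkAlgHom 𝕜 (FreeFieldRel 𝕜)), map_one,
      map_zero] at h
    rw [Matrix.one_apply, ← h, Matrix.mul_apply]
    rfl

/-! ### Specializations of the shifts -/

theorem lift_genS_congr {𝕜 : Type*} [Field 𝕜] {x y : ℕ+ → 𝕜} {k : ℕ}
    (h : ∀ i : ℕ+, (i : ℕ) ≤ k → x i = y i) :
    FreeAlgebra.lift 𝕜 x (genS 𝕜 k) = FreeAlgebra.lift 𝕜 y (genS 𝕜 k) := by
  unfold genS
  split_ifs with hk
  · exact (FreeAlgebra.lift_ι_apply x _).trans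
      ((h ⟨k, hk⟩ le_rfl).trans (FreeAlgebra.lift_ι_apply y _).symm)
  · simp

theorem lift_genS_coe {𝕜 : Type*} [Field 𝕜] (x : ℕ+ → 𝕜) (k : ℕ+) :
    FreeAlgebra.lift 𝕜 x (genS 𝕜 k) = x k := by
  rw [genS, dif_pos k.pos]
  exact FreeAlgebra.lift_ι_apply x _

/-- `S_m^{[s]}` is `S_m` plus a linear combination of the `S_i` with `i < m`, so varying `S_m` alone
moves both by the same amount. -/
theorem lift_shiftS_sub_lift_shiftS {𝕜 : Type*} [Field 𝕜] (a : ℤ → 𝕜) (s : ℤ) {x y : ℕ+ → 𝕜}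
    (m : ℕ) (h : ∀ i : ℕ+, (i : ℕ) < m → x i = y i) :
    FreeAlgebra.lift 𝕜 x (shiftS a s m) - FreeAlgebra.lift 𝕜 y (shiftS a s m) =
      FreeAlgebra.lift 𝕜 x (genS 𝕜 m) - FreeAlgebra.lift 𝕜 y (genS 𝕜 m) := by
  induction m using Nat.strong_induction_on with
  | _ m ih =>
    have hs : ∀ k : Fin m, FreeAlgebra.lift 𝕜 x (shiftS a s k) =
        FreeAlgebra.lift 𝕜 y (shiftS a s k) := fun k => by
      have h1 := ih k k.2 fun i hi => h i (hi.trans k.2)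
      rwa [lift_genS_congr fun i hi => h i (hi.trans_lt k.2), sub_self, sub_eq_zero] at h1
    have hg : ∀ k ∈ Finset.range m,
        PowerSeries.coeff m (invPow a k) • FreeAlgebra.lift 𝕜 x (genS 𝕜 k) =
          PowerSeries.coeff m (invPow a k) • FreeAlgebra.lift 𝕜 y (genS 𝕜 k) := fun k hk => by
      rw [lift_genS_congr fun i hi => h i (hi.trans_lt (Finset.mem_range.1 hk))]
    rw [shiftS, genSeries, PowerSeries.coeff_mk, Finset.sum_range_succ, invPow_coeff_self, one_smul]
    simp only [map_sub, map_add, map_sum, map_smul, hs]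
    rw [Finset.sum_congr rfl hg]
    abel

theorem lift_shiftSZ_congr {𝕜 : Type*} [Field 𝕜] (a : ℤ → 𝕜) (s k : ℤ) {x y : ℕ+ → 𝕜}
    (h : ∀ i : ℕ+, (i : ℤ) ≤ k → x i = y i) :
    FreeAlgebra.lift 𝕜 x (shiftSZ a s k) = FreeAlgebra.lift 𝕜 y (shiftSZ a s k) := by
  unfold shiftSZ
  split_ifs with hk
  · simp
  · have h1 := lift_shiftS_sub_lift_shiftS a s (x := x) (y := y) k.toNat
      fun i hi => h i (by omega)
    rwa [lift_genS_congr fun i hi => h i (by omega), sub_self, sub_eq_zero] at h1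

theorem lift_update_shiftSZ {𝕜 : Type*} [Field 𝕜] (a : ℤ → 𝕜) (s : ℤ) (k : ℕ+) (x : ℕ+ → 𝕜)
    (t : 𝕜) :
    FreeAlgebra.lift 𝕜 (Function.update x k (x k + t)) (shiftSZ a s k) =
      FreeAlgebra.lift 𝕜 x (shiftSZ a s k) + t := by
  have h1 := lift_shiftS_sub_lift_shiftS a s (x := Function.update x k (x k + t)) (y := x) k
    fun i hi => Function.update_of_ne (by rintro rfl; exact lt_irrefl _ hi) _ _
  rw [sub_eq_iff_eq_add] at h1
  have hk : ¬ ((k : ℕ) : ℤ) < 0 := by omega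
  rw [shiftSZ, if_neg hk, Int.toNat_natCast, h1, lift_genS_coe,
    lift_genS_coe, Function.update_self]
  ring

theorem shiftSZ_zero {𝕜 : Type*} [Field 𝕜] (a : ℤ → 𝕜) (s : ℤ) : shiftSZ a s 0 = 1 := by
  rw [shiftSZ, if_neg (lt_irrefl 0), Int.toNat_zero, shiftS]
  simp [genSeries, genS, invPow]

theorem shiftSZ_of_neg {𝕜 : Type*} [Field 𝕜] (a : ℤ → 𝕜) (s : ℤ) {k : ℤ} (hk : k < 0) :
    shiftSZ a s k = 0 := if_pos hk

/-! ### Jacobi–Trudi matrices indexed by the positions of the columns -/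

/-- The matrix with entries `S_{μ_j + p + 1; a}^{[p]}`, `0 ≤ p < s`. -/
noncomputable def posMatrix {𝕜 : Type*} [Field 𝕜] (a : ℤ → 𝕜) {s : ℕ} (μ : Fin s → ℤ) :
    Matrix (Fin s) (Fin s) (Sym 𝕜) :=
  Matrix.of fun p j => shiftSZ a (p : ℤ) (μ j + p + 1)

theorem add_le_of_strictMono {s : ℕ} {μ : Fin (s + 1) → ℤ} (hμ : StrictMono μ) (j : Fin (s + 1)) :
    μ 0 + j ≤ μ j := by
  induction j using Fin.induction with
  | zero => simp
  | succ j ih =>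
    have := hμ (Fin.castSucc_lt_succ (i := j))
    simp only [Fin.val_succ, Fin.val_castSucc] at *
    omega

/-- Induction on the size. If the first position is the lowest allowed, the first column is `(0, …,
0, 1)` and can be expanded away. Otherwise the bottom right entry contains a generator `S_k` that
occurs in no other entry and can be varied freely. -/
theorem exists_det_posMatrix_ne_zero {𝕜 : Type*} [Field 𝕜] (a : ℤ → 𝕜) {s : ℕ} (μ : Fin s → ℤ)
    (hμ : StrictMono μ) (hs : ∀ j, -(s : ℤ) ≤ μ j) :
    ∃ x : ℕ+ → 𝕜, ((posMatrix a μ).map (FreeAlgebra.lift 𝕜 x)).det ≠ 0 := by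
  induction s with
  | zero => exact ⟨fun _ => 0, by simp⟩
  | succ s ih =>
    by_cases h0 : μ 0 = -(s + 1 : ℤ)
    · obtain ⟨x, hx⟩ := ih (fun j => μ j.succ) (hμ.comp Fin.strictMono_succ) fun j => by
        have := add_le_of_strictMono hμ j.succ
        simp only [Fin.val_succ] at this
        push_cast at this
        omega
      refine ⟨x, ?_⟩
      rw [Matrix.det_succ_column_zero, Finset.sum_eq_single (Fin.last s)]
      · have he : (posMatrix a μ).map (FreeAlgebra.lift 𝕜 x) (Fin.last s) 0 = 1 := by
          have : (0 : ℤ) = μ 0 + (Fin.last s : ℕ) + 1 := by rw [h0]; simp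
          simp only [Matrix.map_apply, posMatrix, Matrix.of_apply]
          rw [← this, shiftSZ_zero, map_one]
        rw [he, mul_one]
        refine mul_ne_zero (pow_ne_zero _ (by simp)) ?_
        convert hx using 2
        ext p j
        simp [posMatrix, Fin.succAbove_last]
      · intro p _ hp
        have : μ 0 + (p : ℕ) + 1 < 0 := by
          have := Fin.val_lt_last hp
          omega
        simp only [Matrix.map_apply, posMatrix, Matrix.of_apply]
        rw [shiftSZ_of_neg a _ this]
        simp
      · simp
    · have h0' : -(s : ℤ) ≤ μ 0 := by
        have := hs 0
        push_cast at this
        omega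
      have hj : ∀ j : Fin (s + 1), -(s : ℤ) + j ≤ μ j := fun j => by
        have := add_le_of_strictMono hμ j
        omega
      obtain ⟨x, hx⟩ := ih (fun j => μ j.castSucc) (hμ.comp Fin.strictMono_castSucc) fun j => by
        have := hj j.castSucc
        omega
      by_cases hd : ((posMatrix a μ).map (FreeAlgebra.lift 𝕜 x)).det = 0
      swap
      · exact ⟨x, hd⟩
      have hlast := hj (Fin.last s)
      simp only [Fin.val_last] at hlast
      obtain ⟨k, hk⟩ : ∃ k : ℕ+, (k : ℤ) = μ (Fin.last s) + s + 1 :=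
        ⟨⟨(μ (Fin.last s) + s + 1).toNat, by omega⟩, by simp; omega⟩
      set A := (posMatrix a μ).map (FreeAlgebra.lift 𝕜 x) with hA
      -- The index `μ_j + p + 1` is largest only at the bottom right corner, so raising `S_k` by `1`
      -- adds `1` to that entry alone. The determinant, zero so far, becomes the complementary
      -- minor.
      have hupd : (posMatrix a μ).map (FreeAlgebra.lift 𝕜 (Function.update x k (x k + 1))) =
          A.updateRow (Fin.last s) (A (Fin.last s) + Pi.single (Fin.last s) 1) := by
        ext p j
        by_cases hpj : p = Fin.last s ∧ j = Fin.last s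
        · obtain ⟨rfl, rfl⟩ := hpj
          simp only [hA, Matrix.updateRow_self, Pi.add_apply, Pi.single_eq_same, Matrix.map_apply,
            posMatrix, Matrix.of_apply, Fin.val_last]
          rw [← hk, lift_update_shiftSZ]
        · have hentry : FreeAlgebra.lift 𝕜 (Function.update x k (x k + 1)) (posMatrix a μ p j) =
              A p j := by
            refine lift_shiftSZ_congr a _ _ fun i hi => Function.update_of_ne ?_ _ _
            rintro rfl
            have h1 := Fin.le_last p
            have h2 := hμ.monotone (Fin.le_last j)
            rw [Fin.le_def, Fin.val_last] at h1
            rcases not_and_or.1 hpj with h | h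
            · have := Fin.val_lt_last h
              omega
            · have := hμ (Fin.lt_last_iff_ne_last.2 h)
              omega
          rw [Matrix.map_apply, hentry]
          by_cases hp : p = Fin.last s
          · subst hp
            have : j ≠ Fin.last s := fun h => hpj ⟨rfl, h⟩
            simp [this]
          · rw [Matrix.updateRow_ne hp]
      refine ⟨Function.update x k (x k + 1), ?_⟩
      rw [hupd, Matrix.det_updateRow_add, Matrix.updateRow_eq_self, hd, zero_add,
        ← Matrix.adjugate_apply, Matrix.adjugate_fin_succ_eq_det_submatrix]
      refine mul_ne_zero (pow_ne_zero _ (by simp)) ?_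
      convert hx using 2
      ext p j
      simp [hA, posMatrix, Fin.succAbove_last]

theorem isUnit_posMatrix {𝕜 : Type*} [Field 𝕜] (a : ℤ → 𝕜) {s : ℕ} (μ : Fin s → ℤ)
    (hμ : StrictMono μ) (hs : ∀ j, -(s : ℤ) ≤ μ j) :
    IsUnit ((posMatrix a μ).map (toFreeField 𝕜)) := by
  obtain ⟨x, hx⟩ := exists_det_posMatrix_ne_zero a μ hμ hs
  exact isUnit_map_toFreeField (isFull_of_det_map_ne_zero _ (FreeAlgebra.lift 𝕜 x).toRingHom hx)

/-! ### Quasideterminants and row vectors -/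

/-- Invertibility of the minor forces the remaining coordinates of `v` to be minus the row `p` times
the inverse minor, which is the correction term in the quasideterminant. -/
theorem quasidet_eq_sum_of_annihilates {R : Type*} [Ring R] {n : ℕ}
    {A : Matrix (Fin (n + 1)) (Fin (n + 1)) R} {p q : Fin (n + 1)} (hA : QuasidetDefined A p q)
    (v : Fin (n + 1) → R) (hv : v p = 1) (h : ∀ j, ∑ i, v i * A i (q.succAbove j) = 0) :
    quasidet A p q = ∑ i, v i * A i q := by
  have hinv : minor A p q * Ring.inverse (minor A p q) = 1 := Ring.mul_inverse_cancel _ hA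
  have hw : ∀ j, ∑ i, v (p.succAbove i) * minor A p q i j = -A p (q.succAbove j) := fun j => by
    have := h j
    rw [Fin.sum_univ_succAbove _ p, hv, one_mul] at this
    exact (neg_eq_of_add_eq_zero_right this).symm
  have hrow : ∀ i, v (p.succAbove i) =
      -∑ j, A p (q.succAbove j) * Ring.inverse (minor A p q) j i := fun i => by
    calc v (p.succAbove i) = Matrix.vecMul (fun i => v (p.succAbove i))
          (minor A p q * Ring.inverse (minor A p q)) i := by rw [hinv, Matrix.vecMul_one]
      _ = Matrix.vecMul (fun j => -A p (q.succAbove j)) (Ring.inverse (minor A p q)) i := by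
        rw [← Matrix.vecMul_vecMul]
        congr 2
        exact funext hw
      _ = _ := by simp [Matrix.vecMul, dotProduct]
  rw [quasidet, Fin.sum_univ_succAbove _ p, hv, one_mul, sub_eq_add_neg, Finset.sum_comm,
    ← Finset.sum_neg_distrib]
  congr 1
  refine Finset.sum_congr rfl fun i _ => ?_
  rw [hrow, neg_mul, Finset.sum_mul]

theorem exists_annihilating_row {R : Type*} [Ring R] {n : ℕ}
    {A : Matrix (Fin (n + 1)) (Fin (n + 1)) R} {p q : Fin (n + 1)} (hA : QuasidetDefined A p q) :
    ∃ v : Fin (n + 1) → R, v p = 1 ∧ ∀ j, ∑ i, v i * A i (q.succAbove j) = 0 := by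
  have hinv : Ring.inverse (minor A p q) * minor A p q = 1 := Ring.inverse_mul_cancel _ hA
  refine ⟨p.insertNth 1 (Matrix.vecMul (fun j => -A p (q.succAbove j))
    (Ring.inverse (minor A p q))), by simp, fun j => ?_⟩
  rw [Fin.sum_univ_succAbove _ p]
  simp only [Fin.insertNth_apply_same, Fin.insertNth_apply_succAbove, one_mul]
  have h : ∑ i, Matrix.vecMul (fun j => -A p (q.succAbove j)) (Ring.inverse (minor A p q)) i *
      A (p.succAbove i) (q.succAbove j) = -A p (q.succAbove j) := by
    change Matrix.vecMul (Matrix.vecMul (fun j => -A p (q.succAbove j))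
      (Ring.inverse (minor A p q))) (minor A p q) j = _
    rw [Matrix.vecMul_vecMul, hinv, Matrix.vecMul_one]
  rw [h, add_neg_cancel]

/-! ### Matrices over a noncommutative ring -/

theorem isUnit_submatrix_equiv_of_isUnit {R ι κ : Type*} [Ring R] [Fintype ι] [DecidableEq ι]
    [Fintype κ] [DecidableEq κ] {A : Matrix ι ι R} (hA : IsUnit A) (e f : κ ≃ ι) :
    IsUnit (A.submatrix e f) := by
  obtain ⟨⟨A, B, hAB, hBA⟩, rfl⟩ := hA
  refine ⟨⟨A.submatrix e f, B.submatrix f e, ?_, ?_⟩, rfl⟩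
  · rw [Matrix.submatrix_mul_equiv, hAB, Matrix.submatrix_one_equiv]
  · rw [Matrix.submatrix_mul_equiv, hBA, Matrix.submatrix_one_equiv]

/-- In block form `N` is triangular, with a permutation block at the struck rows and columns. The
inverse of the remaining block is the corresponding submatrix of `N⁻¹`. -/
theorem isUnit_submatrix_of_unit_columns {R ι κ : Type*} [Ring R] [Fintype ι] [DecidableEq ι]
    [Fintype κ] [DecidableEq κ] {N : Matrix ι ι R} (hN : IsUnit N) {f g : κ → ι}
    (hf : Function.Injective f) (hg : Function.Injective g)
    (h₁ : ∀ j ∉ Set.range g, ∃ b ∉ Set.range f, ∀ r, N r j = (1 : Matrix ι ι R) r b)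
    (h₂ : ∀ b ∉ Set.range f, ∃ j ∉ Set.range g, ∀ r, N r j = (1 : Matrix ι ι R) r b) :
    IsUnit (N.submatrix f g) := by
  obtain ⟨⟨N, K, hNK, hKN⟩, rfl⟩ := hN
  dsimp only at h₁ h₂
  refine ⟨⟨N.submatrix f g, K.submatrix g f, ?_, ?_⟩, rfl⟩
  · ext r c
    have h := congrFun₂ hNK (f r) (f c)
    rw [Matrix.mul_apply] at h
    rw [Matrix.mul_apply]
    simp only [Matrix.submatrix_apply]
    rw [Fintype.sum_of_injective g hg _ (fun j => N (f r) j * K j (f c)) ?_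
      fun _ => rfl, h, Matrix.one_apply, Matrix.one_apply]
    · simp [hf.eq_iff]
    · intro j hj
      obtain ⟨b, hb, hNb⟩ := h₁ j hj
      rw [hNb, Matrix.one_apply_ne fun h => hb ⟨r, h⟩, zero_mul]
  · ext r c
    have h := congrFun₂ hKN (g r) (g c)
    rw [Matrix.mul_apply] at h
    rw [Matrix.mul_apply]
    simp only [Matrix.submatrix_apply]
    rw [Fintype.sum_of_injective f hf _ (fun b => K (g r) b * N b (g c)) ?_
      fun _ => rfl, h, Matrix.one_apply, Matrix.one_apply]
    · simp [hg.eq_iff]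
    · intro b hb
      obtain ⟨j, hj, hNj⟩ := h₂ b hb
      have h := congrFun₂ hKN (g r) j
      rw [Matrix.mul_apply, Matrix.one_apply_ne fun h => hj ⟨r, h⟩] at h
      simp only [hNj] at h
      -- Since column `j` of `N` is the unit vector at `b`, entry `(g r, j)` of `K * N` is `K (g r)
      -- b`, which is therefore zero.
      rw [← Matrix.mul_apply, mul_one] at h
      rw [h, zero_mul]

theorem leftInverse_apply_of_lower_unitriangular {R : Type*} [Ring R] {s : ℕ}
    {T L : Matrix (Fin s) (Fin s) R} (hTL : T * L = 1) (h0 : ∀ p j, p < j → L p j = 0)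
    (h1 : ∀ p, L p p = 1) {b p : Fin s} (hbp : b ≤ p) : T b p = (1 : Matrix _ _ R) b p := by
  induction p using WellFoundedGT.induction with
  | ind p ih =>
    rw [← hTL, Matrix.mul_apply, Finset.sum_eq_single p]
    · rw [h1, mul_one]
    · intro q _ hq
      rcases lt_or_gt_of_ne hq with h | h
      · rw [h0 _ _ h, mul_zero]
      · rw [ih q h (hbp.trans h.le), Matrix.one_apply_ne (hbp.trans_lt h).ne, zero_mul]
    · simp

/-! ### The unitriangular matrix of shifts -/

/-- The image in the free skew field of the matrix `(S_{p - j; a}^{[p]})`, `0 ≤ p, j < s`. -/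
noncomputable def shiftTriangle {𝕜 : Type*} [Field 𝕜] (a : ℤ → 𝕜) (s : ℕ) :
    Matrix (Fin s) (Fin s) (FreeField 𝕜) :=
  (posMatrix a fun j : Fin s => -1 - (j : ℤ)).map (toFreeField 𝕜)

theorem shiftTriangle_of_lt {𝕜 : Type*} [Field 𝕜] (a : ℤ → 𝕜) {s : ℕ} (p j : Fin s) (h : p < j) :
    shiftTriangle a s p j = 0 := by
  have h' : (p : ℕ) < j := h
  simp only [shiftTriangle, posMatrix, Matrix.map_apply, Matrix.of_apply]
  rw [shiftSZ_of_neg a _ (by omega), map_zero]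

theorem shiftTriangle_self {𝕜 : Type*} [Field 𝕜] (a : ℤ → 𝕜) {s : ℕ} (p : Fin s) :
    shiftTriangle a s p p = 1 := by
  simp only [shiftTriangle, posMatrix, Matrix.map_apply, Matrix.of_apply]
  rw [show -1 - (p : ℤ) + p + 1 = 0 by ring, shiftSZ_zero, map_one]

/-- Reversing the columns gives the positions `-s, …, -1`. -/
theorem isUnit_shiftTriangle {𝕜 : Type*} [Field 𝕜] (a : ℤ → 𝕜) (s : ℕ) :
    IsUnit (shiftTriangle a s) := by
  have h := isUnit_submatrix_equiv_of_isUnit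
    (isUnit_posMatrix a (fun j : Fin s => (j : ℤ) - s) (fun i j hij => by
      have : (i : ℕ) < j := hij
      dsimp only
      omega) fun j => by omega) (Equiv.refl _) Fin.revPerm
  convert h using 1
  ext p j
  have : -1 - (j : ℤ) = (j.rev : ℕ) - s := by
    rw [Fin.val_rev]
    omega
  simp only [shiftTriangle, posMatrix, Matrix.map_apply, Matrix.of_apply, Matrix.submatrix_apply,
    Fin.revPerm_apply, Equiv.refl_apply, this]

theorem exists_inverse_shiftTriangle {𝕜 : Type*} [Field 𝕜] (a : ℤ → 𝕜) (s : ℕ) :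
    ∃ T : Matrix (Fin s) (Fin s) (FreeField 𝕜),
      T * shiftTriangle a s = 1 ∧ shiftTriangle a s * T = 1 := by
  obtain ⟨u, hu⟩ := isUnit_shiftTriangle a s
  exact ⟨↑u⁻¹, by rw [← hu, u.inv_mul], by rw [← hu, u.mul_inv]⟩

/-! ### The quasi-Schur functions -/

theorem quasiSchurMatrix_eq_posMatrix {𝕜 : Type*} [Field 𝕜] (a : ℤ → 𝕜) {n : ℕ}
    (lam : Fin (n + 1) → ℕ) (p j : Fin (n + 1)) :
    (posMatrix a fun j => (lam j : ℤ) + j - n - 1).map (toFreeField 𝕜) p j =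
      quasiSchurMatrix a lam p.rev j := by
  have h : (n : ℤ) - (p.rev : ℕ) = p := by
    rw [Fin.val_rev]
    omega
  simp only [quasiSchurMatrix, posMatrix, Matrix.map_apply, Matrix.of_apply, h]
  congr 2
  omega

theorem strictMono_position {n : ℕ} {lam : Fin (n + 1) → ℕ} (hmono : Monotone lam) :
    StrictMono fun j => (lam j : ℤ) + j - n - 1 := fun i j hij => by
  have h1 : (i : ℕ) < j := hij
  have h2 := hmono hij.le
  dsimp only
  omega

/-- Positivity of the parts keeps all positions at least `-n`, the bound required for size `n`. -/
theorem isUnit_posMatrix_castSucc {𝕜 : Type*} [Field 𝕜] (a : ℤ → 𝕜) {n : ℕ}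
    {lam : Fin (n + 1) → ℕ} (hmono : Monotone lam) (hpos : ∀ i, 0 < lam i) :
    IsUnit ((posMatrix a fun j : Fin n => (lam j.castSucc : ℤ) + j - n - 1).map
      (toFreeField 𝕜)) := by
  refine isUnit_posMatrix a _ ((strictMono_position hmono).comp Fin.strictMono_castSucc)
    fun j => ?_
  have := hpos j.castSucc
  omega

theorem quasidetDefined_quasiSchurMatrix {𝕜 : Type*} [Field 𝕜] (a : ℤ → 𝕜) {n : ℕ}
    {lam : Fin (n + 1) → ℕ} (hmono : Monotone lam) (hpos : ∀ i, 0 < lam i) :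
    QuasidetDefined (quasiSchurMatrix a lam) 0 (Fin.last n) := by
  unfold QuasidetDefined
  convert isUnit_submatrix_equiv_of_isUnit (isUnit_posMatrix_castSucc a hmono hpos) Fin.revPerm
    (Equiv.refl _) using 1
  ext i j
  have h := quasiSchurMatrix_eq_posMatrix a lam i.rev.castSucc j.castSucc
  rw [Fin.rev_castSucc, Fin.rev_rev] at h
  simp only [minor, Matrix.submatrix_apply, Fin.succAbove_last, Fin.succAbove_zero, ← h]
  rfl

theorem hook_castSucc (b m : ℕ) (j : Fin b) : hook b m j.castSucc = 1 :=
  Fin.snoc_castSucc (α := fun _ => ℕ) _ _ _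

theorem hook_last (b m : ℕ) : hook b m (Fin.last b) = m + 1 :=
  Fin.snoc_last (α := fun _ => ℕ) _ _

theorem hook_pos (b m : ℕ) (i : Fin (b + 1)) : 0 < hook b m i := by
  induction i using Fin.lastCases with
  | last => rw [hook_last]; omega
  | cast i => rw [hook_castSucc]; omega

theorem monotone_hook (b m : ℕ) : Monotone (hook b m) := fun i j hij => by
  induction j using Fin.lastCases with
  | last =>
    induction i using Fin.lastCases with
    | last => exact le_rfl
    | cast i => rw [hook_castSucc, hook_last]; omega
  | cast j =>
    induction i using Fin.lastCases with
    | last => exact absurd hij (not_le.2 (Fin.castSucc_lt_last j))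
    | cast i => rw [hook_castSucc, hook_castSucc]

theorem quasidetDefined_hook {𝕜 : Type*} [Field 𝕜] (a : ℤ → 𝕜) (b m : ℕ) :
    QuasidetDefined (quasiSchurMatrix a (hook b m)) 0 (Fin.last b) :=
  quasidetDefined_quasiSchurMatrix a (monotone_hook b m) (hook_pos b m)

/-- Row `b` of `T` ends with a `1` at `b` and kills columns `0, …, b-1` of the triangle. These are
the columns of the parts equal to `1`, so this row is the annihilating vector of the hook matrix. It
works for every size `s > b`. -/
theorem quasiSchur_hook {𝕜 : Type*} [Field 𝕜] (a : ℤ → 𝕜) {s : ℕ}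
    {T : Matrix (Fin s) (Fin s) (FreeField 𝕜)} (hT : T * shiftTriangle a s = 1) (b : Fin s)
    (m : ℕ) :
    quasiSchur a (hook b m) =
      (-1) ^ (b : ℕ) * ∑ p, T b p * toFreeField 𝕜 (shiftSZ a (p : ℕ) ((m : ℤ) + (p : ℕ) + 1)) := by
  have htri : ∀ {p}, b ≤ p → T b p = (1 : Matrix _ _ _) b p := fun {p} =>
    leftInverse_apply_of_lower_unitriangular hT (shiftTriangle_of_lt a) (shiftTriangle_self a)
  -- Row `i` of the hook matrix carries the shift `[b - i]`.
  let e : Fin (b + 1) → Fin s := fun i => ⟨b - i, by omega⟩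
  have he : Function.Injective e := fun i j hij => by
    have := Fin.val_eq_of_eq hij
    simp only [e] at this
    omega
  have hzero : ∀ p ∉ Set.range e, T b p = 0 := fun p hp => by
    have hlt : b < p := by
      by_contra hle
      have hle' : (p : ℕ) ≤ b := not_lt.1 hle
      refine hp ⟨⟨b - p, by omega⟩, Fin.ext ?_⟩
      simp only [e]
      omega
    rw [htri hlt.le, Matrix.one_apply_ne hlt.ne]
  have hq := quasidet_eq_sum_of_annihilates (quasidetDefined_hook a b m) (fun i => T b (e i)) ?_ ?_
  · rw [quasiSchur, hq]
    congr 1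
    refine Fintype.sum_of_injective e he _ _ (fun p hp => by rw [hzero p hp, zero_mul]) fun i => ?_
    simp only [quasiSchurMatrix, Matrix.of_apply, hook_last, e, Fin.val_last]
    have hi := i.2
    congr 3 <;> push_cast <;> omega
  · have : e 0 = b := Fin.ext (by simp [e])
    simp only [this]
    rw [htri le_rfl, Matrix.one_apply_eq]
  · intro j
    have hj := j.2
    let c : Fin s := ⟨b - 1 - j, by omega⟩
    have hc : b ≠ c := fun h => by
      have := Fin.val_eq_of_eq h
      simp only [c] at this
      omega
    rw [← Matrix.one_apply_ne hc, ← hT, Matrix.mul_apply]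
    refine Fintype.sum_of_injective e he _ _ (fun p hp => by rw [hzero p hp, zero_mul]) fun i => ?_
    simp only [quasiSchurMatrix, Matrix.of_apply, Fin.succAbove_last, hook_castSucc, e, c,
      shiftTriangle, posMatrix, Matrix.map_apply, Fin.val_castSucc]
    have hi := i.2
    congr 3 <;> push_cast <;> omega

/-! ### Frobenius notation -/

theorem le_colLen_of_lt {n : ℕ} {lam : Fin (n + 1) → ℕ} (hmono : Monotone lam) {c : ℕ}
    {j : Fin (n + 1)} (h : c < lam j) : n + 1 - j ≤ colLen lam c := by
  rw [← Fin.card_Ici]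
  refine Finset.card_le_card fun i hi => ?_
  exact Finset.mem_filter.2 ⟨Finset.mem_univ _, h.trans_le (hmono (Finset.mem_Ici.1 hi))⟩

theorem colLen_le_of_le {n : ℕ} {lam : Fin (n + 1) → ℕ} (hmono : Monotone lam) {c : ℕ}
    {j : Fin (n + 1)} (h : lam j ≤ c) : colLen lam c ≤ n - j := by
  rw [show n - (j : ℕ) = n + 1 - 1 - j by omega, ← Fin.card_Ioi]
  refine Finset.card_le_card fun i hi => Finset.mem_Ioi.2 ?_
  by_contra hij
  exact absurd (h.trans_lt (Finset.mem_filter.1 hi).2) (not_lt.2 (hmono (not_lt.1 hij)))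

theorem colLen_le {n : ℕ} (lam : Fin (n + 1) → ℕ) (c : ℕ) : colLen lam c ≤ n + 1 :=
  (Finset.card_le_univ _).trans (Fintype.card_fin _).le

theorem antitone_colLen {n : ℕ} (lam : Fin (n + 1) → ℕ) : Antitone (colLen lam) :=
  fun _ _ hcd => Finset.card_le_card fun _ hi =>
    Finset.mem_filter.2 ⟨Finset.mem_univ _, hcd.trans_lt (Finset.mem_filter.1 hi).2⟩

theorem rowLen_sub {n : ℕ} (lam : Fin (n + 1) → ℕ) (j : Fin (n + 1)) :
    rowLen lam (n - j) = lam j := by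
  rw [rowLen, dif_pos (by omega)]
  congr 1
  ext
  rw [Fin.val_rev]
  simp only
  omega

/-- The columns through the diagonal boxes sit at the positions `α_i`, and the positions of the
remaining columns are `-1 - b`, where `b` runs through the rows that are not of the form `β_i`. -/
theorem IsFrobenius.exists_positions {n k : ℕ} {lam : Fin (n + 1) → ℕ} (hmono : Monotone lam)
    (hpos : ∀ i, 0 < lam i) {β α : Fin (k + 1) → ℕ} (h : IsFrobenius lam β α) :
    ∃ f g : Fin (k + 1) → Fin (n + 1), StrictMono f ∧ StrictMono g ∧
      f (Fin.last k) = Fin.last n ∧ g (Fin.last k) = Fin.last n ∧ (∀ i, (f i : ℕ) = β i) ∧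
      (∀ i, (lam (g i) : ℤ) + (g i : ℕ) - n - 1 = α i) ∧
      (∀ j ∉ Set.range g, ∃ b ∉ Set.range f, (lam j : ℤ) + (j : ℕ) - n - 1 = -1 - (b : ℕ)) ∧
      ∀ b ∉ Set.range f, ∃ j ∉ Set.range g, (lam j : ℤ) + (j : ℕ) - n - 1 = -1 - (b : ℕ) := by
  have hk : k ≤ n := by
    have := (h.diag k).2 k.lt_succ_self
    unfold rowLen at this
    split_ifs at this <;> omega
  have hleg : ∀ i : Fin (k + 1), colLen lam (k - i) = β i + (k - i) + 1 := fun i => by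
    have := h.leg i.rev
    rw [Fin.rev_rev, Fin.val_rev] at this
    rwa [show k - (i : ℕ) = k + 1 - (i + 1) by omega]
  have hβn : ∀ i, β i < n + 1 := fun i => by
    have := hleg i
    have := colLen_le lam (k - i)
    omega
  let f : Fin (k + 1) → Fin (n + 1) := fun i => ⟨β i, hβn i⟩
  let g : Fin (k + 1) → Fin (n + 1) := fun i => ⟨n - (k - i), by omega⟩
  have hf : StrictMono f := fun i j hij => by
    have h1 : (i : ℕ) < j := hij
    have h2 := antitone_colLen lam (show k - (j : ℕ) ≤ k - i by omega)
    rw [hleg, hleg] at h2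
    have := j.2
    change β i < β j
    omega
  have hg : StrictMono g := fun i j hij => by
    have h1 : (i : ℕ) < j := hij
    have := j.2
    change n - (k - (i : ℕ)) < n - (k - (j : ℕ))
    omega
  have hgmem : ∀ j : Fin (n + 1), n - k ≤ j → j ∈ Set.range g := fun j hj =>
    ⟨⟨j - (n - k), by omega⟩, Fin.ext (by simp only [g]; omega)⟩
  have hglt : ∀ j ∉ Set.range g, (j : ℕ) < n - k := fun j hj => by
    by_contra hle
    exact hj (hgmem j (not_lt.1 hle))
  have hle : ∀ j : Fin (n + 1), (j : ℕ) < n - k → lam j + j ≤ n := fun j hj => by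
    have := mt (h.diag (n - j)).1 (by omega)
    rw [rowLen_sub] at this
    omega
  -- Diagonal columns go to their leg lengths, the others to the `b` with position `-1-b`. Once
  -- injective, this self-map of a finite set is surjective, so the values `b` fill the complement
  -- of the legs.
  let e : Fin (n + 1) → Fin (n + 1) := fun j =>
    if hj : n - k ≤ j then f ⟨j - (n - k), by omega⟩ else ⟨n - j - lam j, by omega⟩
  have hne : ∀ (j : Fin (n + 1)) (i : Fin (k + 1)), (j : ℕ) < n - k → n - j - lam j ≠ β i := by
    -- Comparing `λ_j` with the index `k - i` bounds the length of that column from one side,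
    -- forcing `β_i` to be either above or below `n - j - λ_j`.
    intro j i hj heq
    have h1 := hle j hj
    have h2 := hleg i
    rcases lt_or_ge (k - (i : ℕ)) (lam j) with h3 | h3
    · have := le_colLen_of_lt hmono h3
      omega
    · have := colLen_le_of_le hmono h3
      omega
  have he : Function.Injective e := by
    intro i j hij
    simp only [e] at hij
    split_ifs at hij with h1 h2 h2
    · have := Fin.val_eq_of_eq (hf.injective hij)
      simp only at this
      omega
    · exact absurd (Fin.val_eq_of_eq hij).symm (hne j _ (not_le.1 h2))
    · exact absurd (Fin.val_eq_of_eq hij) (hne i _ (not_le.1 h1))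
    · have h3 := Fin.val_eq_of_eq hij
      simp only at h3
      have h4 := hle i (not_le.1 h1)
      have h5 := hle j (not_le.1 h2)
      rcases lt_trichotomy i j with h6 | h6 | h6
      · have := hmono h6.le
        have h7 : (i : ℕ) < j := h6
        omega
      · exact h6
      · have := hmono h6.le
        have h7 : (j : ℕ) < i := h6
        omega
  refine ⟨f, g, hf, hg, ?_, ?_, fun _ => rfl, fun i => ?_, fun j hj => ?_, fun b hb => ?_⟩
  -- All parts are positive, so the first column has full length and the largest leg is `n`.
  · have h1 := hleg (Fin.last k)
    have h2 := le_colLen_of_lt hmono (hpos 0)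
    simp only [Fin.val_last, Nat.sub_self, Fin.val_zero] at h1 h2
    have h3 := hβn (Fin.last k)
    ext
    simp only [f, Fin.val_last]
    omega
  · ext
    simp [g]
  · have h1 := h.arm i.rev
    rw [Fin.rev_rev, Fin.val_rev, show k + 1 - (i + 1) = n - (g i : ℕ) by simp only [g]; omega,
      rowLen_sub] at h1
    omega
  · have hj' := hglt j hj
    refine ⟨⟨n - j - lam j, by omega⟩, ?_, ?_⟩
    · rintro ⟨i, hi⟩
      exact hne j i hj' (Fin.val_eq_of_eq hi).symm
    · have := hle j hj'
      simp only
      omega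
  · obtain ⟨j, rfl⟩ := Finite.injective_iff_surjective.1 he b
    by_cases hj : n - k ≤ (j : ℕ)
    · have hej : e j = f ⟨j - (n - k), by omega⟩ := dif_pos hj
      exact absurd ⟨_, hej.symm⟩ hb
    · refine ⟨j, ?_, ?_⟩
      · rintro ⟨i, rfl⟩
        simp only [g] at hj
        omega
      · have := hle j (not_le.1 hj)
        simp only [e, dif_neg hj]
        omega

/-! ### The Giambelli formula -/

theorem neg_one_pow_mul_self {R : Type*} [Ring R] (n : ℕ) : (-1 : R) ^ n * (-1) ^ n = 1 := by
  rw [← pow_add, Even.neg_one_pow ⟨n, rfl⟩]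

theorem mul_posMatrix_apply_of_nonneg {𝕜 : Type*} [Field 𝕜] (a : ℤ → 𝕜) {s : ℕ}
    {T : Matrix (Fin s) (Fin s) (FreeField 𝕜)} (hT : T * shiftTriangle a s = 1) {μ : Fin s → ℤ}
    (b j : Fin s) {m : ℕ} (hm : μ j = m) :
    (T * (posMatrix a μ).map (toFreeField 𝕜)) b j = (-1) ^ (b : ℕ) * quasiSchur a (hook b m) := by
  rw [quasiSchur_hook a hT, ← mul_assoc, neg_one_pow_mul_self, one_mul,
    Matrix.mul_apply]
  simp only [posMatrix, Matrix.map_apply, Matrix.of_apply, hm]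

theorem mul_posMatrix_apply_of_neg {𝕜 : Type*} [Field 𝕜] (a : ℤ → 𝕜) {s : ℕ}
    {T : Matrix (Fin s) (Fin s) (FreeField 𝕜)} (hT : T * shiftTriangle a s = 1) {μ : Fin s → ℤ}
    (b j : Fin s) {c : Fin s} (hc : μ j = -1 - (c : ℕ)) :
    (T * (posMatrix a μ).map (toFreeField 𝕜)) b j = (1 : Matrix _ _ _) b c := by
  rw [← hT, Matrix.mul_apply, Matrix.mul_apply]
  simp only [posMatrix, shiftTriangle, Matrix.map_apply, Matrix.of_apply, hc]

theorem quasidetDefined_giambelliMatrix {𝕜 : Type*} [Field 𝕜] (a : ℤ → 𝕜) {n k : ℕ}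
    {lam : Fin (n + 1) → ℕ} (hmono : Monotone lam) (hpos : ∀ i, 0 < lam i)
    {β α : Fin (k + 1) → ℕ} (hfrob : IsFrobenius lam β α) :
    QuasidetDefined (giambelliMatrix a β α) (Fin.last k) (Fin.last k) := by
  obtain ⟨f, g, hf, hg, hfl, hgl, hfβ, hgα, h₁, h₂⟩ := hfrob.exists_positions hmono hpos
  -- Size `n` suffices: the struck corner of the hook matrix belongs to row and column `n`.
  obtain ⟨T, hTL, hLT⟩ := exists_inverse_shiftTriangle a n
  have hTu : IsUnit T := ⟨⟨T, _, hTL, hLT⟩, rfl⟩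
  have hN := hTu.mul (isUnit_posMatrix_castSucc a hmono hpos)
  have hlt : ∀ {F : Fin (k + 1) → Fin (n + 1)}, StrictMono F → F (Fin.last k) = Fin.last n →
      ∀ i : Fin k, F i.castSucc ≠ Fin.last n := fun hF hl i => by
    rw [← hl]
    exact (hF (Fin.castSucc_lt_last i)).ne
  let f' : Fin k → Fin n := fun i => (f i.castSucc).castPred (hlt hf hfl i)
  let g' : Fin k → Fin n := fun i => (g i.castSucc).castPred (hlt hg hgl i)
  have hf' : ∀ i, (f' i).castSucc = f i.castSucc := fun i => Fin.castSucc_castPred _ _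
  have hg' : ∀ i, (g' i).castSucc = g i.castSucc := fun i => Fin.castSucc_castPred _ _
  have hrange : ∀ {F : Fin (k + 1) → Fin (n + 1)} {F' : Fin k → Fin n},
      (∀ i, (F' i).castSucc = F i.castSucc) → F (Fin.last k) = Fin.last n →
      ∀ j, j.castSucc ∉ Set.range F ↔ j ∉ Set.range F' := fun {F F'} h hl j => by
    refine not_congr ⟨?_, ?_⟩
    · rintro ⟨i, hi⟩
      induction i using Fin.lastCases with
      | last => exact absurd (hi.symm.trans hl) (Fin.castSucc_lt_last j).ne
      | cast i => exact ⟨i, Fin.castSucc_injective _ ((h i).trans hi)⟩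
    · rintro ⟨i, rfl⟩
      exact ⟨_, (h i).symm⟩
  have hnl : ∀ {F : Fin (k + 1) → Fin (n + 1)} {j}, F (Fin.last k) = Fin.last n →
      j ∉ Set.range F → ∃ i : Fin n, i.castSucc = j := fun {F j} hl hj =>
    Fin.exists_castSucc_eq.2 fun h => hj ⟨_, hl.trans h.symm⟩
  have hinj : ∀ {F : Fin (k + 1) → Fin (n + 1)} {F' : Fin k → Fin n},
      (∀ i, (F' i).castSucc = F i.castSucc) → StrictMono F → Function.Injective F' :=
    fun {F F'} h hF i j hij => Fin.castSucc_injective _ (hF.injective (by rw [← h, ← h, hij]))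
  have hsub := isUnit_submatrix_of_unit_columns hN (hinj hf' hf) (hinj hg' hg) ?_ ?_
  · have hD : IsUnit (Matrix.diagonal fun i : Fin k => (-1 : FreeField 𝕜) ^ β i.castSucc) := by
      have : (Matrix.diagonal fun i : Fin k => (-1 : FreeField 𝕜) ^ β i.castSucc) *
          (Matrix.diagonal fun i : Fin k => (-1 : FreeField 𝕜) ^ β i.castSucc) = 1 := by
        rw [Matrix.diagonal_mul_diagonal, ← Matrix.diagonal_one]
        congr 1
        funext i
        rw [neg_one_pow_mul_self]
      exact ⟨⟨_, _, this, this⟩, rfl⟩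
    unfold QuasidetDefined
    convert hD.mul hsub using 1
    ext i j
    have hfi : ((f' i : Fin n) : ℕ) = β i.castSucc := by
      rw [← hfβ, ← hf', Fin.val_castSucc]
    have hgj : (lam (g' j).castSucc : ℤ) + (g' j : ℕ) - n - 1 = α j.castSucc := by
      rw [← hgα, ← hg', Fin.val_castSucc]
    rw [Matrix.diagonal_mul, Matrix.submatrix_apply, mul_posMatrix_apply_of_nonneg a hTL _ _ hgj,
      hfi, ← mul_assoc, neg_one_pow_mul_self, one_mul]
    simp only [minor, giambelliMatrix, Matrix.submatrix_apply, Fin.succAbove_last, Matrix.of_apply]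
  · intro j hj
    obtain ⟨b, hb, hjb⟩ := h₁ j.castSucc ((hrange hg' hgl j).2 hj)
    obtain ⟨b, rfl⟩ := hnl hfl hb
    exact ⟨b, (hrange hf' hfl b).1 hb, fun r => mul_posMatrix_apply_of_neg a hTL _ _ hjb⟩
  · intro b hb
    obtain ⟨j, hj, hjb⟩ := h₂ b.castSucc ((hrange hf' hfl b).2 hb)
    obtain ⟨j, rfl⟩ := hnl hgl hj
    exact ⟨j, (hrange hg' hgl j).1 hj, fun r => mul_posMatrix_apply_of_neg a hTL _ _ hjb⟩

theorem quasiSchur_eq_quasidet_giambelliMatrix {𝕜 : Type*} [Field 𝕜] (a : ℤ → 𝕜) {n k : ℕ}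
    {lam : Fin (n + 1) → ℕ} (hmono : Monotone lam) (hpos : ∀ i, 0 < lam i)
    {β α : Fin (k + 1) → ℕ} (hfrob : IsFrobenius lam β α) :
    quasiSchur a lam = quasidet (giambelliMatrix a β α) (Fin.last k) (Fin.last k) := by
  obtain ⟨f, g, hf, hg, hfl, hgl, hfβ, hgα, h₁, h₂⟩ := hfrob.exists_positions hmono hpos
  obtain ⟨T, hTL, hLT⟩ := exists_inverse_shiftTriangle a (n + 1)
  have hdef := quasidetDefined_quasiSchurMatrix a hmono hpos
  obtain ⟨v, hv, hv0⟩ := exists_annihilating_row hdef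
  set M := (posMatrix a fun j => (lam j : ℤ) + j - n - 1).map (toFreeField 𝕜) with hM
  -- Chosen so that `u (T M) = v M_λ`, where `v` is read in reversed row order.
  let u : Fin (n + 1) → FreeField 𝕜 := Matrix.vecMul (fun p => v p.rev) (shiftTriangle a (n + 1))
  have hu : ∀ j, ∑ b, u b * (T * M) b j = ∑ i, v i * quasiSchurMatrix a lam i j := fun j => by
    change Matrix.vecMul (Matrix.vecMul (fun p => v p.rev) (shiftTriangle a (n + 1))) (T * M) j = _
    rw [Matrix.vecMul_vecMul, ← mul_assoc, hLT, one_mul]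
    rw [← Equiv.sum_comp Fin.revPerm fun i => v i * quasiSchurMatrix a lam i j]
    change ∑ p : Fin (n + 1), v p.rev * M p j = _
    exact Finset.sum_congr rfl fun p _ =>
      congrArg (v p.rev * ·) (quasiSchurMatrix_eq_posMatrix a lam p j)
  have hu1 : u (Fin.last n) = 1 := by
    change ∑ p : Fin (n + 1), v p.rev * shiftTriangle a (n + 1) p (Fin.last n) = 1
    rw [Finset.sum_eq_single (Fin.last n), shiftTriangle_self, Fin.rev_last, hv, one_mul]
    · intro p _ hp
      rw [shiftTriangle_of_lt a _ _ (Fin.lt_last_iff_ne_last.2 hp), mul_zero]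
    · simp
  have hu0 : ∀ b ∉ Set.range f, u b = 0 := fun b hb => by
    obtain ⟨j, hj, hjb⟩ := h₂ b hb
    obtain ⟨i, rfl⟩ := Fin.exists_castSucc_eq.2 fun h => hj ⟨_, hgl.trans h.symm⟩
    have h := hv0 i
    rw [Fin.succAbove_last, ← hu] at h
    have hcol := fun r => mul_posMatrix_apply_of_neg (μ := fun j => (lam j : ℤ) + j - n - 1) a hTL r
      i.castSucc hjb
    simp only [hM, hcol] at h
    simpa [Matrix.one_apply] using h
  -- The factor `(-1)^{β_i}` undoes the sign of row `β_i`. The factor `(-1)^n` normalizes the last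
  -- coordinate, as the largest leg is `n`, and supplies the sign of `S̆_λ`.
  have hsum : ∀ j, ∑ i, (-1) ^ n * u (f i) * (-1) ^ β i * giambelliMatrix a β α i j =
      (-1) ^ n * ∑ i, v i * quasiSchurMatrix a lam i (g j) := fun j => by
    rw [← hu, Finset.mul_sum]
    refine Fintype.sum_of_injective f hf.injective _ _
      (fun b hb => by rw [hu0 b hb, zero_mul, mul_zero]) fun i => ?_
    rw [hM, mul_posMatrix_apply_of_nonneg (μ := fun j => (lam j : ℤ) + j - n - 1) a hTL _ _ (hgα j), hfβ, giambelliMatrix,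
      Matrix.of_apply]
    simp only [mul_assoc]
  have hβ : β (Fin.last k) = n := by rw [← hfβ, hfl, Fin.val_last]
  rw [quasidet_eq_sum_of_annihilates (quasidetDefined_giambelliMatrix a hmono hpos hfrob)
    (fun i => (-1) ^ n * u (f i) * (-1) ^ β i), hsum, hgl, quasiSchur,
    quasidet_eq_sum_of_annihilates hdef v hv hv0]
  · rw [hfl, hu1, hβ, mul_one, neg_one_pow_mul_self]
  · intro j
    rw [hsum, Fin.succAbove_last]
    have hne : g j.castSucc ≠ Fin.last n := by
      rw [← hgl]
      exact (hg (Fin.castSucc_lt_last j)).ne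
    obtain ⟨i, hi⟩ := Fin.exists_castSucc_eq.2 hne
    have h := hv0 i
    rw [Fin.succAbove_last, hi] at h
    rw [h, mul_zero]

end ShiftedNSym

theorem mainTheorem9 {𝕜 : Type*} [Field 𝕜] (a : ℤ → 𝕜) {n k : ℕ}
    (lam : Fin (n + 1) → ℕ) (hmono : Monotone lam) (hpos : ∀ i, 0 < lam i)
    (β α : Fin (k + 1) → ℕ) (hfrob : IsFrobenius lam β α) :
    QuasidetDefined (quasiSchurMatrix a lam) 0 (Fin.last n) ∧
    (∀ i j, QuasidetDefined (quasiSchurMatrix a (hook (β i) (α j))) 0 (Fin.last (β i))) ∧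
    QuasidetDefined (giambelliMatrix a β α) (Fin.last k) (Fin.last k) ∧
    quasiSchur a lam = quasidet (giambelliMatrix a β α) (Fin.last k) (Fin.last k) :=
  ⟨quasidetDefined_quasiSchurMatrix a hmono hpos, fun _ _ => quasidetDefined_hook a _ _,
    quasidetDefined_giambelliMatrix a hmono hpos hfrob,
    quasiSchur_eq_quasidet_giambelliMatrix a hmono hpos hfrob⟩
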